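/- Let $R$ be an integral domain with quotient field $K$. Say that $R$ has the \emph{Z-property} if whenever $a,b,c,d,e\in R$ are nonzero nonunits with $abc=de$, then $ab$ and $d$ have a common nonunit divisor or $ab$ and $e$ have a common nonunit divisor. For a nonzero fractional ideal $I$ put $I^{-1}=(R:_K I)$ and $I_v=(I^{-1})^{-1}$; $I$ is divisorial if $I=I_v$. If $R$ is a Krull domain, its divisor class group $Cl(R)$ is the group of divisorial fractional ideals under $(I,J)\mapsto (IJ)_v$, modulo the subgroup of nonzero principal fractional ideals. If $R$ is a Krull domain that has the Z-property, then $Cl(R)$ is a torsion group (i.e. $R$ is almost factorial). -/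

import Mathlib

open scoped nonZeroDivisors

/-- The Z-property of a domain: whenever `a, b, c, d, e` are nonzero nonunits with `abc = de`, then
`[ab, d] ≠ 1` or `[ab, e] ≠ 1`. Here `[u, v] = 1` means that `1` is a greatest common divisor of
`u` and `v`, that is, that every common divisor of `u` and `v` is a unit (`IsRelPrime u v`). -/
def HasZProperty (R : Type*) [CommRing R] [IsDomain R] : Prop :=
  ∀ a b c d e : R,
    (a ≠ 0 ∧ ¬ IsUnit a) → (b ≠ 0 ∧ ¬ IsUnit b) → (c ≠ 0 ∧ ¬ IsUnit c) →
    (d ≠ 0 ∧ ¬ IsUnit d) → (e ≠ 0 ∧ ¬ IsUnit e) →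
    a * b * c = d * e →
    ¬ IsRelPrime (a * b) d ∨ ¬ IsRelPrime (a * b) e

/-- A domain `R` is a Krull domain if `R_P` is a discrete valuation ring for every height-one
prime `P`, if `R` is the intersection of these `R_P` inside its fraction field, and if every nonzero
element of `R` lies in only finitely many height-one primes. (Fields are Krull domains.) -/
structure IsKrullDomain (R : Type*) [CommRing R] [IsDomain R] : Prop where
  isDiscreteValuationRing : ∀ (P : Ideal R) [P.IsPrime], P.height = 1 →
    IsDiscreteValuationRing (Localization.AtPrime P)
  mem_range_of_forall_mem_localization : ∀ x : FractionRing R,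
    (∀ P : Ideal R, P.IsPrime → P.height = 1 →
      ∃ a s : R, s ∉ P ∧ x = algebraMap R (FractionRing R) a / algebraMap R (FractionRing R) s) →
    x ∈ (algebraMap R (FractionRing R)).range
  finite_height_one : ∀ r : R, r ≠ 0 →
    {P : Ideal R | P.IsPrime ∧ P.height = 1 ∧ r ∈ P}.Finite

section Divisorial

variable {R K : Type*} [CommRing R] [IsDomain R] [Field K] [Algebra R K] [IsFractionRing R K]

/-- The `v`-operation `I_v = (I⁻¹)⁻¹` on fractional ideals, where `I⁻¹ = 1 / I = (R :_K I)`. -/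
noncomputable def vClosure (I : FractionalIdeal R⁰ K) : FractionalIdeal R⁰ K := 1 / (1 / I)

theorem fractionalIdeal_mul_ne_zero {I J : FractionalIdeal R⁰ K} (hI : I ≠ 0) (hJ : J ≠ 0) :
    I * J ≠ 0 := by
  obtain ⟨x, hx, hx0⟩ : ∃ x ∈ I, x ≠ 0 := by
    by_contra! h
    exact hI (FractionalIdeal.eq_zero_iff.mpr h)
  obtain ⟨y, hy, hy0⟩ : ∃ y ∈ J, y ≠ 0 := by
    by_contra! h
    exact hJ (FractionalIdeal.eq_zero_iff.mpr h)
  intro h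
  exact mul_ne_zero hx0 hy0
    (FractionalIdeal.eq_zero_iff.mp h _ (FractionalIdeal.mul_mem_mul hx hy))

theorem one_div_ne_zero_of_ne_zero {I : FractionalIdeal R⁰ K} (hI : I ≠ 0) : 1 / I ≠ 0 := by
  obtain ⟨a, J, ha, rfl⟩ := FractionalIdeal.exists_eq_spanSingleton_mul I
  have haK : algebraMap R K a ≠ 0 := by
    simpa using ha
  intro h
  have hm : algebraMap R K a ∈
      1 / (FractionalIdeal.spanSingleton R⁰ (algebraMap R K a)⁻¹ * (J : FractionalIdeal R⁰ K)) := by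
    rw [FractionalIdeal.mem_div_iff_of_ne_zero hI]
    intro y hy
    obtain ⟨z, hz, rfl⟩ := FractionalIdeal.mem_singleton_mul.mp hy
    rw [mul_inv_cancel_left₀ haK]
    exact FractionalIdeal.coeIdeal_le_one hz
  rw [h] at hm
  exact haK ((FractionalIdeal.mem_zero_iff _).mp hm)

theorem vClosure_ne_zero {I : FractionalIdeal R⁰ K} (hI : I ≠ 0) : vClosure I ≠ 0 :=
  one_div_ne_zero_of_ne_zero (one_div_ne_zero_of_ne_zero hI)

theorem le_one_div_comm {I J : FractionalIdeal R⁰ K} (hI : I ≠ 0) (hJ : J ≠ 0) :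
    I ≤ 1 / J ↔ J ≤ 1 / I := by
  rw [FractionalIdeal.le_div_iff_mul_le hJ, FractionalIdeal.le_div_iff_mul_le hI, mul_comm]

theorem le_vClosure {I : FractionalIdeal R⁰ K} (hI : I ≠ 0) : I ≤ vClosure I :=
  (le_one_div_comm (one_div_ne_zero_of_ne_zero hI) hI).mp le_rfl

theorem one_div_anti {I J : FractionalIdeal R⁰ K} (hI : I ≠ 0) (hIJ : I ≤ J) : 1 / J ≤ 1 / I := by
  have hJ : J ≠ 0 := fun h => hI (le_antisymm (h ▸ hIJ) (FractionalIdeal.zero_le I))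
  exact (le_one_div_comm hI (one_div_ne_zero_of_ne_zero hJ)).mp (hIJ.trans (le_vClosure hJ))

theorem one_div_vClosure {I : FractionalIdeal R⁰ K} (hI : I ≠ 0) : 1 / vClosure I = 1 / I :=
  le_antisymm (one_div_anti hI (le_vClosure hI)) (le_vClosure (one_div_ne_zero_of_ne_zero hI))

theorem vClosure_vClosure {I : FractionalIdeal R⁰ K} (hI : I ≠ 0) :
    vClosure (vClosure I) = vClosure I := by
  unfold vClosure
  exact congrArg (1 / ·) (one_div_vClosure hI)

theorem one_div_mul_vClosure {I J : FractionalIdeal R⁰ K} (hI : I ≠ 0) (hJ : J ≠ 0) :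
    1 / (vClosure I * J) = 1 / (I * J) := by
  have hIJ := fractionalIdeal_mul_ne_zero hI hJ
  refine le_antisymm (one_div_anti hIJ (mul_le_mul_left (le_vClosure hI) J)) ?_
  have h1 := fractionalIdeal_mul_ne_zero (vClosure_ne_zero hI) hJ
  have hle : 1 / (I * J) * J ≤ 1 / I := by
    rw [FractionalIdeal.le_div_iff_mul_le hI, mul_assoc, mul_comm J I]
    exact (FractionalIdeal.le_div_iff_mul_le hIJ).mp le_rfl
  rw [← one_div_vClosure hI, FractionalIdeal.le_div_iff_mul_le (vClosure_ne_zero hI)] at hle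
  rw [FractionalIdeal.le_div_iff_mul_le h1, mul_comm (vClosure I) J, ← mul_assoc]
  exact hle

theorem vClosure_mul_vClosure {I J : FractionalIdeal R⁰ K} (hI : I ≠ 0) (hJ : J ≠ 0) :
    vClosure (vClosure I * J) = vClosure (I * J) :=
  congrArg (1 / ·) (one_div_mul_vClosure hI hJ)

theorem one_div_spanSingleton_mul {x : K} (hx : x ≠ 0) {I : FractionalIdeal R⁰ K} (hI : I ≠ 0) :
    1 / (FractionalIdeal.spanSingleton R⁰ x * I) =
      FractionalIdeal.spanSingleton R⁰ x⁻¹ * (1 / I) := by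
  have hxs : FractionalIdeal.spanSingleton R⁰ x ≠ 0 :=
    FractionalIdeal.spanSingleton_ne_zero_iff.mpr hx
  have hinv : FractionalIdeal.spanSingleton R⁰ x⁻¹ * FractionalIdeal.spanSingleton R⁰ x = 1 := by
    rw [FractionalIdeal.spanSingleton_mul_spanSingleton, inv_mul_cancel₀ hx,
      FractionalIdeal.spanSingleton_one]
  have hxI := fractionalIdeal_mul_ne_zero hxs hI
  apply le_antisymm
  · have h : 1 / (FractionalIdeal.spanSingleton R⁰ x * I) * FractionalIdeal.spanSingleton R⁰ x
        ≤ 1 / I := by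
      rw [FractionalIdeal.le_div_iff_mul_le hI, mul_assoc]
      exact (FractionalIdeal.le_div_iff_mul_le hxI).mp le_rfl
    calc 1 / (FractionalIdeal.spanSingleton R⁰ x * I)
        = FractionalIdeal.spanSingleton R⁰ x⁻¹ *
          (1 / (FractionalIdeal.spanSingleton R⁰ x * I) *
            FractionalIdeal.spanSingleton R⁰ x) := by
          rw [mul_comm (1 / _), ← mul_assoc, hinv, one_mul]
      _ ≤ _ := mul_le_mul_right h _
  · rw [FractionalIdeal.le_div_iff_mul_le hxI]
    calc FractionalIdeal.spanSingleton R⁰ x⁻¹ * (1 / I) *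
          (FractionalIdeal.spanSingleton R⁰ x * I)
        = (FractionalIdeal.spanSingleton R⁰ x⁻¹ * FractionalIdeal.spanSingleton R⁰ x) *
          (1 / I * I) := by ring
      _ = 1 / I * I := by rw [hinv, one_mul]
      _ ≤ 1 := (FractionalIdeal.le_div_iff_mul_le hI).mp le_rfl

theorem vClosure_spanSingleton_mul {x : K} (hx : x ≠ 0) {I : FractionalIdeal R⁰ K} (hI : I ≠ 0) :
    vClosure (FractionalIdeal.spanSingleton R⁰ x * I) =
      FractionalIdeal.spanSingleton R⁰ x * vClosure I := by
  unfold vClosure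
  rw [one_div_spanSingleton_mul hx hI,
    one_div_spanSingleton_mul (inv_ne_zero hx) (one_div_ne_zero_of_ne_zero hI), inv_inv]

variable (R K) in
/-- The divisorial fractional ideals (`v`-ideals) of `R`: nonzero fractional ideals with
`I_v = I`. -/
def DivisorialIdeal : Type _ := {I : FractionalIdeal R⁰ K // I ≠ 0 ∧ vClosure I = I}

namespace DivisorialIdeal

/-- The product of divisorial ideals is `(I, J) ↦ (IJ)_v`, with neutral element `R`. -/
noncomputable instance : CommMonoid (DivisorialIdeal R K) where
  mul I J := ⟨vClosure (I.1 * J.1), vClosure_ne_zero (fractionalIdeal_mul_ne_zero I.2.1 J.2.1),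
    vClosure_vClosure (fractionalIdeal_mul_ne_zero I.2.1 J.2.1)⟩
  one := ⟨1, one_ne_zero, by
    unfold vClosure
    rw [FractionalIdeal.div_one, FractionalIdeal.div_one]⟩
  mul_assoc I J L := Subtype.ext <| by
    change vClosure (vClosure (I.1 * J.1) * L.1) = vClosure (I.1 * vClosure (J.1 * L.1))
    rw [vClosure_mul_vClosure (fractionalIdeal_mul_ne_zero I.2.1 J.2.1) L.2.1, mul_comm I.1 (vClosure _),
      vClosure_mul_vClosure (fractionalIdeal_mul_ne_zero J.2.1 L.2.1) I.2.1]
    congr 1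
    ring
  one_mul I := Subtype.ext <| by
    change vClosure (1 * I.1) = I.1
    rw [one_mul, I.2.2]
  mul_one I := Subtype.ext <| by
    change vClosure (I.1 * 1) = I.1
    rw [mul_one, I.2.2]
  mul_comm I J := Subtype.ext <| by
    change vClosure (I.1 * J.1) = vClosure (J.1 * I.1)
    rw [mul_comm]

theorem coe_mul (I J : DivisorialIdeal R K) : (I * J).1 = vClosure (I.1 * J.1) := rfl

theorem coe_one : (1 : DivisorialIdeal R K).1 = 1 := rfl

variable (R K) in
/-- Linear equivalence of divisorial ideals: `I ∼ J` if `J = xI` for some nonzero `x ∈ K`. -/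
def linearEquivalence : Con (DivisorialIdeal R K) where
  r I J := ∃ x : K, x ≠ 0 ∧ J.1 = FractionalIdeal.spanSingleton R⁰ x * I.1
  iseqv :=
    { refl := fun I => ⟨1, one_ne_zero, by
        rw [FractionalIdeal.spanSingleton_one, one_mul]⟩
      symm := by
        rintro I J ⟨x, hx, h⟩
        refine ⟨x⁻¹, inv_ne_zero hx, ?_⟩
        rw [h, ← mul_assoc, FractionalIdeal.spanSingleton_mul_spanSingleton, inv_mul_cancel₀ hx,
          FractionalIdeal.spanSingleton_one, one_mul]
      trans := by
        rintro I J L ⟨x, hx, h⟩ ⟨y, hy, h'⟩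
        refine ⟨y * x, mul_ne_zero hy hx, ?_⟩
        rw [h', h, ← mul_assoc, FractionalIdeal.spanSingleton_mul_spanSingleton] }
  mul' := by
    rintro I J I' J' ⟨x, hx, h⟩ ⟨y, hy, h'⟩
    refine ⟨x * y, mul_ne_zero hx hy, ?_⟩
    rw [coe_mul, coe_mul, h, h', ← vClosure_spanSingleton_mul (mul_ne_zero hx hy)
      (fractionalIdeal_mul_ne_zero I.2.1 I'.2.1), ← FractionalIdeal.spanSingleton_mul_spanSingleton]
    congr 1
    ring

end DivisorialIdeal

end Divisorial

/-- The divisor class group `Cl(R)`: the divisorial fractional ideals under `v`-multiplication,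
modulo the principal ones. For an arbitrary domain this is a commutative monoid; it is a group when
`R` is a Krull domain. -/
abbrev DivisorClassGroup (R K : Type*) [CommRing R] [IsDomain R] [Field K] [Algebra R K]
    [IsFractionRing R K] : Type _ :=
  (DivisorialIdeal.linearEquivalence R K).Quotient

/-!
The height-one primes `P` of a Krull domain `R` give valuations on `R`, and so to every nonzero
element `r` its divisor `div r`, a finitely supported function on the height-one primes. Divisors
turn products into sums and divisibility into `≤` (`IsKrullDomain.div_le_div_iff`), and units are the
elements with divisor `0`.

The heart of the argument is that under the Z-property each height-one prime `P` has a positive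
multiple which is the divisor of an element (`IsKrullDomain.exists_div_eq_single`). Suppose not, and
let `x ∈ P` be nonzero with `div x = n P + B` of minimal support, `B` not involving `P`. Minimality
forces that every element whose divisor is supported on `B` is a unit
(`IsKrullDomain.div_eq_zero_of_support_minimal`), and by assumption every element whose divisor is a
multiple of `P` is a unit. Approximation produces `d` and `e` with `div d = 2n P + C` and
`div e = 2B + C'`, where `C` and `C'` do not involve the primes of `div x`. Then `x * x * c = d * e`
for some nonunit `c`. A common divisor of `x * x` and `d` has as divisor a multiple of `P`, and a
common divisor of `x * x` and `e` has its divisor supported on `B`. Both are therefore units, and the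
Z-property fails.

A class in `Cl(R)` is represented by a nonzero ideal `I` of `R`. If `m P` is the least valuation at
`P` on `I`, and `N` is a common multiple of the orders of the finitely many `P` with `m P ≠ 0`, then
some element `x` has divisor `∑ N (m P) P`, and `(I ^ N)_v = xR` because both `(I ^ N)⁻¹` and
`x⁻¹R` are cut out by the same inequalities between valuations
(`IsKrullDomain.exists_vClosure_pow_eq_spanSingleton`).
-/

/-! ### Valuations and divisors on a Krull domain -/

/-- The height-one primes of a domain. -/
def HeightOnePrime (R : Type*) [CommRing R] : Type _ :=
  {P : Ideal R // P.IsPrime ∧ P.height = 1}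

namespace HeightOnePrime

variable {R : Type*} [CommRing R]

instance isPrime (P : HeightOnePrime R) : P.1.IsPrime := P.2.1

theorem eq_of_le {P Q : HeightOnePrime R} (h : P.1 ≤ Q.1) : P = Q := by
  have : P.1.FiniteHeight := ⟨Or.inr (by rw [P.2.2]; exact ENat.one_ne_top)⟩
  exact Subtype.ext (Ideal.eq_of_le_of_height_le _ h (by rw [P.2.2, Q.2.2]))

theorem exists_mem_ne_zero [IsDomain R] (P : HeightOnePrime R) : ∃ x ∈ P.1, x ≠ 0 := by
  refine Submodule.exists_mem_ne_zero_of_ne_bot fun h => ?_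
  have := P.2.2
  rw [h, Ideal.height_bot] at this
  exact zero_ne_one this

end HeightOnePrime

namespace IsKrullDomain

variable {R : Type*} [CommRing R] [IsDomain R] (hR : IsKrullDomain R)

/-- The normalized valuation at a height-one prime `P`: the valuation of the discrete valuation ring
`R_P`, restricted to `R`. -/
noncomputable def ord (P : HeightOnePrime R) : AddValuation R ℕ∞ :=
  haveI := hR.isDiscreteValuationRing P.1 P.2.2
  (IsDiscreteValuationRing.addVal (Localization.AtPrime P.1)).comap
    (algebraMap R (Localization.AtPrime P.1))

theorem ord_eq_top_iff {P : HeightOnePrime R} {r : R} : hR.ord P r = ⊤ ↔ r = 0 := by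
  have := hR.isDiscreteValuationRing P.1 P.2.2
  change IsDiscreteValuationRing.addVal _ (algebraMap R (Localization.AtPrime P.1) r) = ⊤ ↔ _
  rw [IsDiscreteValuationRing.addVal_eq_top_iff]
  exact map_eq_zero_iff _
    (IsLocalization.injective _ P.1.primeCompl_le_nonZeroDivisors)

theorem ord_eq_zero_iff {P : HeightOnePrime R} {r : R} : hR.ord P r = 0 ↔ r ∉ P.1 := by
  have := hR.isDiscreteValuationRing P.1 P.2.2
  change IsDiscreteValuationRing.addVal _ (algebraMap R (Localization.AtPrime P.1) r) = 0 ↔ _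
  rw [IsDiscreteValuationRing.addVal_eq_zero_iff]
  exact IsLocalization.AtPrime.isUnit_to_map_iff _ P.1 r

theorem le_ord_of_mem_pow {P : HeightOnePrime R} {I : Ideal R} {m : ℕ}
    (hI : ∀ a ∈ I, (m : ℕ∞) ≤ hR.ord P a) (n : ℕ) {r : R} (hr : r ∈ I ^ n) :
    ((n * m : ℕ) : ℕ∞) ≤ hR.ord P r := by
  induction n generalizing r with
  | zero => simp
  | succ n ih =>
    rw [pow_succ] at hr
    refine Submodule.mul_induction_on hr (fun a ha b hb => ?_)
      fun a b ha hb => (le_min ha hb).trans ((hR.ord P).map_add a b)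
    rw [(hR.ord P).map_mul, add_mul, one_mul, Nat.cast_add]
    exact add_le_add (ih ha) (hI b hb)

theorem le_ord_of_mem_prime_pow {P : HeightOnePrime R} (n : ℕ) {r : R} (hr : r ∈ P.1 ^ n) :
    (n : ℕ∞) ≤ hR.ord P r := by
  have h := hR.le_ord_of_mem_pow (P := P) (I := P.1) (m := 1) (fun a ha => ?_) n hr
  · simpa using h
  · rw [Nat.cast_one, Order.one_le_iff_pos, pos_iff_ne_zero]
    exact fun h => hR.ord_eq_zero_iff.mp h ha

/-- In a Krull domain divisibility is detected by the valuations at the height-one primes. -/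
theorem dvd_of_ord_le {r s : R} (hs : s ≠ 0) (h : ∀ P, hR.ord P s ≤ hR.ord P r) : s ∣ r := by
  have hinj := FaithfulSMul.algebraMap_injective R (FractionRing R)
  have hsF : algebraMap R (FractionRing R) s ≠ 0 := (map_ne_zero_iff _ hinj).mpr hs
  obtain ⟨q, hq⟩ : algebraMap R (FractionRing R) r / algebraMap R (FractionRing R) s ∈
      (algebraMap R (FractionRing R)).range := by
    refine hR.mem_range_of_forall_mem_localization _ fun P hP hP1 => ?_
    have hle := h ⟨P, hP, hP1⟩
    have := hR.isDiscreteValuationRing P hP1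
    obtain ⟨z, hz⟩ := IsDiscreteValuationRing.addVal_le_iff_dvd.mp hle
    obtain ⟨⟨a, t⟩, hat⟩ := IsLocalization.surj P.primeCompl z
    have hPinj := IsLocalization.injective (Localization.AtPrime P)
      P.primeCompl_le_nonZeroDivisors
    have key : r * t = a * s := by
      apply hPinj
      rw [map_mul, map_mul]
      simp only at hat
      rw [← hat]
      simp only at hz
      rw [hz]
      ring
    have htF : algebraMap R (FractionRing R) t ≠ 0 := by
      refine (map_ne_zero_iff _ hinj).mpr fun h0 => t.2 ?_
      rw [h0]
      exact P.zero_mem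
    refine ⟨a, t, t.2, ?_⟩
    rw [div_eq_div_iff hsF htF, ← map_mul, ← map_mul, key]
  refine ⟨q, hinj ?_⟩
  rw [map_mul, hq, mul_div_cancel₀ _ hsF]

theorem finite_support_ord (r : R) : (Function.support fun P => (hR.ord P r).toNat).Finite := by
  rcases eq_or_ne r 0 with rfl | hr
  · simp [Function.support]
  · refine ((hR.finite_height_one r hr).preimage Subtype.val_injective.injOn).subset fun P hP => ?_
    refine ⟨P.2.1, P.2.2, by_contra fun h => hP ?_⟩
    simp [hR.ord_eq_zero_iff.mpr h]

/-- The divisor of an element, with the convention that the divisor of `0` is `0`. -/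
noncomputable def div (r : R) : HeightOnePrime R →₀ ℕ :=
  Finsupp.ofSupportFinite (fun P => (hR.ord P r).toNat) (hR.finite_support_ord r)

theorem div_apply (r : R) (P : HeightOnePrime R) : hR.div r P = (hR.ord P r).toNat := rfl

theorem coe_div {r : R} (hr : r ≠ 0) (P : HeightOnePrime R) : (hR.div r P : ℕ∞) = hR.ord P r :=
  ENat.natCast_toNat fun h => hr (hR.ord_eq_top_iff.mp h)

theorem div_mul {r s : R} (hr : r ≠ 0) (hs : s ≠ 0) : hR.div (r * s) = hR.div r + hR.div s := by
  ext P
  rw [← Nat.cast_inj (R := ℕ∞), Finsupp.add_apply, Nat.cast_add, hR.coe_div hr, hR.coe_div hs,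
    hR.coe_div (mul_ne_zero hr hs), (hR.ord P).map_mul]

theorem div_one : hR.div (1 : R) = 0 := by
  ext P
  simp [div_apply]

theorem div_pow {r : R} (hr : r ≠ 0) (n : ℕ) : hR.div (r ^ n) = n • hR.div r := by
  induction n with
  | zero => rw [pow_zero, zero_smul, div_one]
  | succ n ih => rw [pow_succ, hR.div_mul (pow_ne_zero n hr) hr, ih, succ_nsmul]

theorem div_prod {ι : Type*} (s : Finset ι) {f : ι → R} (hf : ∀ i ∈ s, f i ≠ 0) :
    hR.div (∏ i ∈ s, f i) = ∑ i ∈ s, hR.div (f i) := by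
  classical
  induction s using Finset.induction_on with
  | empty => simp [div_one]
  | insert a s ha ih =>
    rw [Finset.prod_insert ha, Finset.sum_insert ha, hR.div_mul (hf a (by simp))
      (Finset.prod_ne_zero_iff.mpr fun i hi => hf i (by simp [hi])),
      ih fun i hi => hf i (by simp [hi])]

theorem div_le_div_iff {r s : R} (hr : r ≠ 0) (hs : s ≠ 0) : hR.div r ≤ hR.div s ↔ r ∣ s := by
  constructor
  · intro h
    refine hR.dvd_of_ord_le hr fun P => ?_
    rw [← hR.coe_div hr, ← hR.coe_div hs]
    exact_mod_cast h P
  · rintro ⟨t, rfl⟩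
    rw [hR.div_mul hr (right_ne_zero_of_mul hs)]
    exact le_self_add

theorem isUnit_iff_div_eq_zero {r : R} (hr : r ≠ 0) : IsUnit r ↔ hR.div r = 0 := by
  rw [isUnit_iff_dvd_one, ← hR.div_le_div_iff hr one_ne_zero, div_one, nonpos_iff_eq_zero]

theorem div_apply_eq_zero_iff {r : R} (hr : r ≠ 0) {P : HeightOnePrime R} :
    hR.div r P = 0 ↔ r ∉ P.1 := by
  rw [← hR.ord_eq_zero_iff, ← hR.coe_div hr, Nat.cast_eq_zero]

/-- If `y` has larger valuation at `P` than `x`, then `x + y` has the valuation of `x`. -/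
theorem div_add_apply {x y : R} {P : HeightOnePrime R} (hx : x ≠ 0) (hxy : x + y ≠ 0)
    (hy : y ∈ P.1 ^ (hR.div x P + 1)) : hR.div (x + y) P = hR.div x P := by
  rw [← Nat.cast_inj (R := ℕ∞), hR.coe_div hxy, hR.coe_div hx]
  refine (hR.ord P).map_add_eq_of_lt_left (lt_of_lt_of_le ?_ (hR.le_ord_of_mem_prime_pow _ hy))
  rw [← hR.coe_div hx]
  exact_mod_cast Nat.lt_succ_self _

end IsKrullDomain

/-! ### Height-one primes have a principal multiple -/

namespace HeightOnePrime

variable {R : Type*} [CommRing R]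

theorem exists_mem_pow_forall_notMem {P : HeightOnePrime R} {S : Finset (HeightOnePrime R)}
    (hP : P ∉ S) (n : ℕ) : ∃ y ∈ P.1 ^ n, ∀ Q ∈ S, y ∉ Q.1 := by
  have h : ¬ ((P.1 ^ n : Ideal R) : Set R) ⊆ ⋃ Q ∈ (S : Set (HeightOnePrime R)), (Q.1 : Set R) := by
    rw [Ideal.subset_union_prime (f := fun Q : HeightOnePrime R => Q.1) P P
      fun Q _ _ _ => Q.isPrime]
    rintro ⟨Q, hQ, hle⟩
    have hPQ := HeightOnePrime.eq_of_le (Ideal.IsPrime.le_of_pow_le hle)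
    exact hP (hPQ ▸ hQ)
  obtain ⟨y, hy, hyS⟩ := Set.not_subset.mp h
  exact ⟨y, hy, fun Q hQ hyQ => hyS (Set.mem_biUnion (Finset.mem_coe.mpr hQ) hyQ)⟩

theorem exists_notMem_forall_mem_pow {P : HeightOnePrime R} {S : Finset (HeightOnePrime R)}
    (hP : P ∉ S) (m : HeightOnePrime R → ℕ) : ∃ y ∉ P.1, ∀ Q ∈ S, y ∈ Q.1 ^ m Q := by
  have h : ¬ ∏ Q ∈ S, Q.1 ^ m Q ≤ P.1 := by
    rw [Ideal.IsPrime.prod_le P.isPrime]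
    rintro ⟨Q, hQ, hle⟩
    have hPQ := HeightOnePrime.eq_of_le (Ideal.IsPrime.le_of_pow_le hle)
    exact hP (hPQ ▸ hQ)
  obtain ⟨y, hy, hyP⟩ := SetLike.not_le_iff_exists.mp h
  exact ⟨y, hyP, fun Q hQ => (Ideal.prod_le_inf.trans (Finset.inf_le hQ)) hy⟩

end HeightOnePrime

namespace IsKrullDomain

variable {R : Type*} [CommRing R] [IsDomain R] (hR : IsKrullDomain R)

/-- Suppose the support of `div x` is minimal among the supports of divisors of nonzero elements of
`P`. Then no nonunit has its divisor supported in `supp (div x) \ {P}`: otherwise a power of it could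
be divided out of a power of `x`, keeping `P` in the support but removing another prime. -/
theorem div_eq_zero_of_support_minimal {P : HeightOnePrime R} {x : R} (hx : x ≠ 0) (hxP : x ∈ P.1)
    (hmin : ∀ y : R, y ≠ 0 → y ∈ P.1 → ¬ (hR.div y).support ⊂ (hR.div x).support)
    {c : R} (hc : c ≠ 0) (hcP : c ∉ P.1) (hcx : (hR.div c).support ⊆ (hR.div x).support) :
    hR.div c = 0 := by
  by_contra h0
  -- The prime at which `x` is smallest relative to `c` is the first one to be exhausted.
  obtain ⟨Q, hQ, hQmin⟩ := Finset.exists_min_image (hR.div c).support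
    (fun Q => (hR.div x Q : ℚ) / hR.div c Q) (Finsupp.support_nonempty_iff.mpr h0)
  have hdvd : c ^ hR.div x Q ∣ x ^ hR.div c Q := by
    rw [← hR.div_le_div_iff (pow_ne_zero _ hc) (pow_ne_zero _ hx), hR.div_pow hc, hR.div_pow hx]
    intro Q'
    rw [Finsupp.smul_apply, Finsupp.smul_apply, smul_eq_mul, smul_eq_mul]
    by_cases hQ' : Q' ∈ (hR.div c).support
    · have h := hQmin Q' hQ'
      rw [div_le_div_iff₀ (by exact_mod_cast Nat.pos_of_ne_zero (Finsupp.mem_support_iff.mp hQ))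
        (by exact_mod_cast Nat.pos_of_ne_zero (Finsupp.mem_support_iff.mp hQ'))] at h
      rw [mul_comm (hR.div c Q)]
      exact_mod_cast h
    · rw [Finsupp.notMem_support_iff.mp hQ', mul_zero]
      exact Nat.zero_le _
  obtain ⟨y, hy⟩ := hdvd
  have hy0 : y ≠ 0 := by
    rintro rfl
    exact pow_ne_zero _ hx (by rw [hy, mul_zero])
  have hdiv : hR.div c Q • hR.div x = hR.div x Q • hR.div c + hR.div y := by
    rw [← hR.div_pow hx, hy, hR.div_mul (pow_ne_zero _ hc) hy0, hR.div_pow hc]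
  have hval (Q' : HeightOnePrime R) :
      hR.div c Q * hR.div x Q' = hR.div x Q * hR.div c Q' + hR.div y Q' := by
    simpa using DFunLike.congr_fun hdiv Q'
  refine hmin y hy0 ?_ ((Finset.ssubset_iff_of_subset fun Q' hQ' => ?_).mpr ⟨Q, hcx hQ, ?_⟩)
  · by_contra hyP
    have h := hval P
    rw [(hR.div_apply_eq_zero_iff hc).mpr hcP, (hR.div_apply_eq_zero_iff hy0).mpr hyP, mul_zero,
      add_zero, mul_eq_zero] at h
    exact h.elim (Finsupp.mem_support_iff.mp hQ)
      fun h => (hR.div_apply_eq_zero_iff hx).mp h hxP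
  · rw [Finsupp.mem_support_iff] at hQ' ⊢
    intro h
    have := hval Q'
    rw [h, mul_zero] at this
    omega
  · rw [Finsupp.notMem_support_iff]
    have := hval Q
    rw [mul_comm] at this
    omega

/-- In a Krull domain with the Z-property every height-one prime has a positive multiple that is
the divisor of an element. -/
theorem exists_div_eq_single (hZ : HasZProperty R) (P : HeightOnePrime R) :
    ∃ n : ℕ, 0 < n ∧ ∃ x : R, x ≠ 0 ∧ hR.div x = Finsupp.single P n := by
  classical
  by_contra! hP
  obtain ⟨x, ⟨hx, hxP⟩, hmin⟩ : ∃ x : R, (x ≠ 0 ∧ x ∈ P.1) ∧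
      ∀ y : R, y ≠ 0 → y ∈ P.1 → ¬ (hR.div y).support ⊂ (hR.div x).support := by
    obtain ⟨z, hzP, hz⟩ := P.exists_mem_ne_zero
    obtain ⟨x, hx, hmin⟩ := (measure fun x : R => (hR.div x).support.card).wf.has_min
      {x | x ≠ 0 ∧ x ∈ P.1} ⟨z, hz, hzP⟩
    exact ⟨x, hx, fun y hy hyP hlt => hmin y ⟨hy, hyP⟩ (Finset.card_lt_card hlt)⟩
  set S := (hR.div x).support.erase P with hS
  have hPS : P ∉ S := Finset.notMem_erase _ _
  have hx2 : x ^ 2 ≠ 0 := pow_ne_zero 2 hx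
  have hval {Q : HeightOnePrime R} (hQ : Q ∈ S) : x ∈ Q.1 := by
    by_contra h
    exact Finsupp.mem_support_iff.mp (Finset.mem_of_mem_erase hQ)
      ((hR.div_apply_eq_zero_iff hx).mpr h)
  have hout {Q : HeightOnePrime R} (hQP : Q ≠ P) (hQ : Q ∉ S) : hR.div (x ^ 2) Q = 0 := by
    rw [hR.div_pow hx, Finsupp.smul_apply, Finsupp.notMem_support_iff.mp fun h =>
      hQ (Finset.mem_erase.mpr ⟨hQP, h⟩), smul_zero]
  have hposP : hR.div (x ^ 2) P ≠ 0 := by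
    rw [Ne, hR.div_apply_eq_zero_iff hx2, not_not]
    exact Ideal.pow_mem_of_mem _ hxP 2 two_pos
  -- By assumption, an element whose divisor is concentrated at `P` has divisor `0`.
  have hsingle {r : R} (hr : r ≠ 0) (h : ∀ Q, Q ≠ P → hR.div r Q = 0) : hR.div r = 0 := by
    have hrP : hR.div r = Finsupp.single P (hR.div r P) := by
      ext Q
      by_cases hQ : Q = P
      · rw [hQ, Finsupp.single_eq_same]
      · rw [h Q hQ, Finsupp.single_eq_of_ne hQ]
    rcases Nat.eq_zero_or_pos (hR.div r P) with h0 | h0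
    · rw [hrP, h0, Finsupp.single_zero]
    · exact absurd hrP (hP _ h0 r hr)
  -- `d = x ^ 2 + y` carries the `P`-part of `x ^ 2` and none of the rest.
  obtain ⟨y, hyP, hyS⟩ := HeightOnePrime.exists_mem_pow_forall_notMem hPS (hR.div (x ^ 2) P + 1)
  obtain ⟨Q₀, hQ₀⟩ : S.Nonempty := by
    rw [Finset.nonempty_iff_ne_empty]
    intro hS0
    refine hposP (DFunLike.congr_fun (hsingle hx2 fun Q hQ => hout hQ ?_) P)
    rw [hS0]
    exact Finset.notMem_empty Q
  have hdS {Q : HeightOnePrime R} (hQ : Q ∈ S) : x ^ 2 + y ∉ Q.1 := fun h =>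
    hyS Q hQ ((Ideal.add_mem_iff_right _ (Ideal.pow_mem_of_mem _ (hval hQ) 2 two_pos)).mp h)
  have hd : x ^ 2 + y ≠ 0 := fun h => hdS hQ₀ (h ▸ Q₀.1.zero_mem)
  have hdP : hR.div (x ^ 2 + y) P = hR.div (x ^ 2) P := hR.div_add_apply hx2 hd hyP
  -- `e = x ^ 2 + z` carries the rest of `x ^ 2` and none of its `P`-part.
  obtain ⟨z, hzP, hzS⟩ := HeightOnePrime.exists_notMem_forall_mem_pow hPS
    fun Q => hR.div (x ^ 2) Q + 1
  have heP : x ^ 2 + z ∉ P.1 := fun h =>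
    hzP ((Ideal.add_mem_iff_right _ (Ideal.pow_mem_of_mem _ hxP 2 two_pos)).mp h)
  have he : x ^ 2 + z ≠ 0 := fun h => heP (h ▸ P.1.zero_mem)
  have heS {Q : HeightOnePrime R} (hQ : Q ∈ S) : hR.div (x ^ 2 + z) Q = hR.div (x ^ 2) Q :=
    hR.div_add_apply hx2 he (hzS Q hQ)
  generalize x ^ 2 + y = d at *
  generalize x ^ 2 + z = e at *
  obtain ⟨c, hc⟩ : x ^ 2 ∣ d * e := by
    rw [← hR.div_le_div_iff hx2 (mul_ne_zero hd he), hR.div_mul hd he]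
    intro Q
    rw [Finsupp.add_apply]
    by_cases hQP : Q = P
    · rw [hQP, hdP]
      exact Nat.le_add_right _ _
    · by_cases hQ : Q ∈ S
      · rw [heS hQ]
        exact Nat.le_add_left _ _
      · rw [hout hQP hQ]
        exact Nat.zero_le _
  have hc0 : c ≠ 0 := by
    rintro rfl
    exact mul_ne_zero hd he (by rw [hc, mul_zero])
  have hdP0 : hR.div d P ≠ 0 := hdP ▸ hposP
  have hmem {r : R} (hr : r ≠ 0) {Q : HeightOnePrime R} (h : hR.div r Q ≠ 0) : ¬ IsUnit r := by
    rw [hR.isUnit_iff_div_eq_zero hr]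
    exact fun h0 => h (by rw [h0, Finsupp.zero_apply])
  have hsum : hR.div d + hR.div e = hR.div (x ^ 2) + hR.div c := by
    rw [← hR.div_mul hd he, hc, hR.div_mul hx2 hc0]
  have hcu : ¬ IsUnit c := by
    rw [hR.isUnit_iff_div_eq_zero hc0]
    intro h0
    refine hdP0 (DFunLike.congr_fun (hsingle hd fun Q hQP => ?_) P)
    by_cases hQ : Q ∈ S
    · exact (hR.div_apply_eq_zero_iff hd).mpr (hdS hQ)
    · have h := DFunLike.congr_fun hsum Q
      rw [h0, add_zero, Finsupp.add_apply, hout hQP hQ] at h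
      exact (Nat.add_eq_zero_iff.mp h).1
  have hxu : ¬ IsUnit x := fun h => P.isPrime.ne_top (Ideal.eq_top_of_isUnit_mem _ hxP h)
  have heu : ¬ IsUnit e := by
    refine hmem he (Q := Q₀) ?_
    rw [heS hQ₀, Ne, hR.div_apply_eq_zero_iff hx2, not_not]
    exact Ideal.pow_mem_of_mem _ (hval hQ₀) 2 two_pos
  rcases hZ x x c d e ⟨hx, hxu⟩ ⟨hx, hxu⟩ ⟨hc0, hcu⟩ ⟨hd, hmem hd hdP0⟩ ⟨he, heu⟩
    (by rw [← sq, hc]) with h | h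
  · refine h fun r hrx hrd => ?_
    rw [← sq] at hrx
    have hr : r ≠ 0 := ne_zero_of_dvd_ne_zero hd hrd
    rw [hR.isUnit_iff_div_eq_zero hr]
    refine hsingle hr fun Q hQP => ?_
    by_cases hQ : Q ∈ S
    · exact Nat.le_zero.mp (((hR.div_le_div_iff hr hd).mpr hrd Q).trans
        ((hR.div_apply_eq_zero_iff hd).mpr (hdS hQ)).le)
    · exact Nat.le_zero.mp (((hR.div_le_div_iff hr hx2).mpr hrx Q).trans (hout hQP hQ).le)
  · refine h fun r hrx hre => ?_
    rw [← sq] at hrx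
    have hr : r ≠ 0 := ne_zero_of_dvd_ne_zero he hre
    rw [hR.isUnit_iff_div_eq_zero hr]
    refine hR.div_eq_zero_of_support_minimal hx hxP hmin hr
      (fun hrP => heP (Ideal.mem_of_dvd _ hre hrP)) fun Q hQ => ?_
    rw [Finsupp.mem_support_iff] at hQ ⊢
    intro h0
    refine hQ (Nat.le_zero.mp (((hR.div_le_div_iff hr hx2).mpr hrx Q).trans ?_))
    rw [hR.div_pow hx, Finsupp.smul_apply, h0, smul_zero]

end IsKrullDomain

/-! ### Powers of ideals with principal divisorial closure -/

section Divisorial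

variable {R K : Type*} [CommRing R] [IsDomain R] [Field K] [Algebra R K] [IsFractionRing R K]

/-- An ideal `J` satisfies `J_v = xR` as soon as `x` divides `J` and, for all fractions `r / s`, the
inclusion `(r / s) J ⊆ R` implies `(r / s) x ∈ R`. -/
theorem vClosure_coeIdeal_eq_spanSingleton {J : Ideal R} (hJ : J ≠ ⊥) {x : R} (hx : x ≠ 0)
    (hdvd : ∀ j ∈ J, x ∣ j) (hgen : ∀ r s : R, s ≠ 0 → (∀ j ∈ J, s ∣ r * j) → s ∣ r * x) :
    vClosure (J : FractionalIdeal R⁰ K) = FractionalIdeal.spanSingleton R⁰ (algebraMap R K x) := by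
  have hinj := FaithfulSMul.algebraMap_injective R K
  have hxK : algebraMap R K x ≠ 0 := (map_ne_zero_iff _ hinj).mpr hx
  have hJ0 : (J : FractionalIdeal R⁰ K) ≠ 0 := FractionalIdeal.coeIdeal_ne_zero.mpr hJ
  have hinv : 1 / (J : FractionalIdeal R⁰ K) =
      FractionalIdeal.spanSingleton R⁰ (algebraMap R K x)⁻¹ := by
    apply le_antisymm
    · intro y hy
      rw [FractionalIdeal.mem_div_iff_of_ne_zero hJ0] at hy
      obtain ⟨r, s, hs, rfl⟩ := IsFractionRing.div_surjective (A := R) y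
      have hs0 : s ≠ 0 := nonZeroDivisors.ne_zero hs
      have hsK : algebraMap R K s ≠ 0 := (map_ne_zero_iff _ hinj).mpr hs0
      obtain ⟨t, ht⟩ := hgen r s hs0 fun j hj => by
        obtain ⟨t, ht⟩ := (FractionalIdeal.mem_one_iff _).mp
          (hy _ (FractionalIdeal.mem_coeIdeal_of_mem _ hj))
        refine ⟨t, hinj ?_⟩
        rw [map_mul, map_mul, ht]
        field_simp
      refine (FractionalIdeal.mem_spanSingleton _).mpr ⟨t, ?_⟩
      rw [Algebra.smul_def]
      field_simp
      rw [← map_mul, ← map_mul, mul_comm x r, ht, mul_comm]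
    · rw [FractionalIdeal.spanSingleton_le_iff_mem, FractionalIdeal.mem_div_iff_of_ne_zero hJ0]
      intro y hy
      obtain ⟨j, hj, rfl⟩ := (FractionalIdeal.mem_coeIdeal _).mp hy
      obtain ⟨t, rfl⟩ := hdvd j hj
      rw [map_mul, inv_mul_cancel_left₀ hxK]
      exact (FractionalIdeal.mem_one_iff _).mpr ⟨t, rfl⟩
  have h := one_div_spanSingleton_mul (inv_ne_zero hxK) (one_ne_zero (α := FractionalIdeal R⁰ K))
  rw [mul_one, FractionalIdeal.div_one, mul_one, inv_inv] at h
  rw [vClosure, hinv, h]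

theorem DivisorialIdeal.coe_pow (I : DivisorialIdeal R K) (n : ℕ) :
    (I ^ n).1 = vClosure (I.1 ^ n) := by
  have hpow (n : ℕ) : I.1 ^ n ≠ 0 := by
    induction n with
    | zero => rw [pow_zero]; exact one_ne_zero
    | succ n ih => rw [pow_succ]; exact fractionalIdeal_mul_ne_zero ih I.2.1
  induction n with
  | zero => rw [pow_zero, pow_zero]; exact ((1 : DivisorialIdeal R K).2.2).symm
  | succ n ih =>
    rw [pow_succ, DivisorialIdeal.coe_mul, ih, vClosure_mul_vClosure (hpow n) I.2.1, pow_succ]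

end Divisorial

/-- If every height-one prime has a principal multiple, then so has every nonzero ideal `I` for the
`v`-operation. With `m P` the least valuation at `P` of an element of `I`, the divisor of `I` is
`∑ P, m P • P`, and a common multiple of the orders of the primes involved annihilates its class. -/
theorem IsKrullDomain.exists_vClosure_pow_eq_spanSingleton {R : Type*} (K : Type*) [CommRing R]
    [IsDomain R] [Field K] [Algebra R K] [IsFractionRing R K] (hR : IsKrullDomain R)
    (hP : ∀ P : HeightOnePrime R, ∃ n : ℕ, 0 < n ∧ ∃ x : R, x ≠ 0 ∧ hR.div x = Finsupp.single P n)
    {I : Ideal R} (hI : I ≠ ⊥) :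
    ∃ n : ℕ, 0 < n ∧ ∃ x : R, x ≠ 0 ∧ vClosure ((I ^ n : Ideal R) : FractionalIdeal R⁰ K) =
      FractionalIdeal.spanSingleton R⁰ (algebraMap R K x) := by
  classical
  choose n hn x hx hdiv using hP
  obtain ⟨a₀, ha₀I, ha₀⟩ := Submodule.exists_mem_ne_zero_of_ne_bot hI
  have hmin (P : HeightOnePrime R) : ∃ a ∈ I, a ≠ 0 ∧
      ∀ b ∈ I, b ≠ 0 → hR.div a P ≤ hR.div b P := by
    obtain ⟨a, ⟨haI, ha⟩, h⟩ := (measure fun a : R => hR.div a P).wf.has_min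
      {a | a ∈ I ∧ a ≠ 0} ⟨a₀, ha₀I, ha₀⟩
    exact ⟨a, haI, ha, fun b hb hb0 => not_lt.mp (h b ⟨hb, hb0⟩)⟩
  choose a haI ha hmin using hmin
  set S := (hR.div a₀).support
  set N := ∏ P ∈ S, n P
  have hN : 0 < N := Finset.prod_pos fun P _ => hn P
  set g := ∏ P ∈ S, x P ^ (hR.div (a P) P * (N / n P))
  have hg : g ≠ 0 := Finset.prod_ne_zero_iff.mpr fun P _ => pow_ne_zero _ (hx P)
  have hgP (P : HeightOnePrime R) : hR.div g P = N * hR.div (a P) P := by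
    rw [hR.div_prod _ fun P _ => pow_ne_zero _ (hx P), Finsupp.finsetSum_apply]
    have hterm (Q : HeightOnePrime R) : hR.div (x Q ^ (hR.div (a Q) Q * (N / n Q))) P =
        if Q = P then hR.div (a Q) Q * (N / n Q) * n Q else 0 := by
      rw [hR.div_pow (hx Q), hdiv, Finsupp.smul_apply, Finsupp.single_apply, smul_eq_mul, mul_ite,
        mul_zero]
    simp_rw [hterm]
    rw [Finset.sum_ite_eq']
    split_ifs with hPS
    · rw [mul_assoc, Nat.div_mul_cancel (Finset.dvd_prod_of_mem n hPS), mul_comm]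
    · have h := hmin P a₀ ha₀I ha₀
      rw [Finsupp.notMem_support_iff.mp hPS] at h
      rw [Nat.le_zero.mp h, mul_zero]
  refine ⟨N, hN, g, hg, vClosure_coeIdeal_eq_spanSingleton ?_ hg (fun j hj => ?_)
    fun r s hs h => ?_⟩
  · intro h
    have := Ideal.pow_mem_pow ha₀I N
    rw [h, Ideal.mem_bot] at this
    exact pow_ne_zero _ ha₀ this
  · refine hR.dvd_of_ord_le hg fun P => ?_
    rw [← hR.coe_div hg, hgP]
    refine hR.le_ord_of_mem_pow (fun b hb => ?_) N hj
    by_cases hb0 : b = 0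
    · rw [hb0, (hR.ord P).map_zero]
      exact le_top
    · rw [← hR.coe_div hb0]
      exact_mod_cast hmin P b hb hb0
  · refine hR.dvd_of_ord_le hs fun P => ?_
    by_cases hr : r = 0
    · rw [hr, zero_mul, (hR.ord P).map_zero]
      exact le_top
    have haN : a P ^ N ≠ 0 := pow_ne_zero N (ha P)
    have h1 := (hR.div_le_div_iff hs (mul_ne_zero hr haN)).mpr
      (h _ (Ideal.pow_mem_pow (haI P) N)) P
    rw [← hR.coe_div hs, ← hR.coe_div (mul_ne_zero hr hg), Nat.cast_le, hR.div_mul hr hg,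
      Finsupp.add_apply, hgP]
    rwa [hR.div_mul hr haN, hR.div_pow (ha P)] at h1

theorem mainTheorem3 (R K : Type*) [CommRing R] [IsDomain R] [Field K] [Algebra R K]
    [IsFractionRing R K] (hR : IsKrullDomain R) (hZ : HasZProperty R) :
    IsMulTorsion (DivisorClassGroup R K) := by
  intro C
  obtain ⟨I, rfl⟩ := Con.mk'_surjective C
  rw [isOfFinOrder_iff_pow_eq_one]
  obtain ⟨b, J, hb, hIJ⟩ := FractionalIdeal.exists_eq_spanSingleton_mul I.1
  have hbK : algebraMap R K b ≠ 0 :=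
    (map_ne_zero_iff _ (FaithfulSMul.algebraMap_injective R K)).mpr hb
  have hJ : J ≠ ⊥ := by
    rintro rfl
    exact I.2.1 (by rw [hIJ, FractionalIdeal.coeIdeal_bot, mul_zero])
  obtain ⟨n, hn, x, hx, hv⟩ :=
    hR.exists_vClosure_pow_eq_spanSingleton K (hR.exists_div_eq_single hZ) hJ
  have hxK : algebraMap R K x ≠ 0 :=
    (map_ne_zero_iff _ (FaithfulSMul.algebraMap_injective R K)).mpr hx
  have hJn : ((J ^ n : Ideal R) : FractionalIdeal R⁰ K) ≠ 0 :=
    FractionalIdeal.coeIdeal_ne_zero.mpr (pow_ne_zero n hJ)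
  refine ⟨n, hn, ?_⟩
  rw [← map_pow, ← map_one (DivisorialIdeal.linearEquivalence R K).mk']
  refine ((DivisorialIdeal.linearEquivalence R K).eq.mpr
    ⟨((algebraMap R K b)⁻¹ ^ n) * algebraMap R K x, mul_ne_zero (pow_ne_zero n (inv_ne_zero hbK)) hxK,
      ?_⟩).symm
  rw [DivisorialIdeal.coe_one, mul_one, DivisorialIdeal.coe_pow, hIJ, mul_pow,
    FractionalIdeal.spanSingleton_pow, ← FractionalIdeal.coeIdeal_pow,
    vClosure_spanSingleton_mul (pow_ne_zero n (inv_ne_zero hbK)) hJn, hv,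
    FractionalIdeal.spanSingleton_mul_spanSingleton]
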